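/- For a real or complex Banach space $E$ (over $\mathbb K=\mathbb R$ or $\mathbb C$) and nonnegative integers $k_1,\dots,k_n$ with $k_1+\cdots+k_n=m$, let $\mathbb K(k_1,\dots,k_n;E)$ denote the infimum of all $M>0$ such that $$\sup_{\|x_1\|\le 1,\dots,\|x_n\|\le 1}\bigl|L(x_1^{k_1}\cdots x_n^{k_n})\bigr|\le M\sup_{\|x\|\le 1}|L(x,\dots,x)|$$ for every continuous symmetric $m$-linear form $L:E^m\to\mathbb K$, where $L(x_1^{k_1}\cdots x_n^{k_n})$ is the value of $L$ at the $m$-tuple in which each $x_i$ is repeated $k_i$ times. Let $X$ be a real Banach space and let $\widetilde X=X\oplus iX$ be its complexification, i.e. $X\times X$ with $(\alpha+i\beta)(x,y)=(\alpha x-\beta y,\ \beta x+\alpha y)$, where $(x,y)$ is written $x+iy$. Let $\widetilde X$ carry any complex norm that extends the norm of $X$ (that is, $\|x+i0\|=\|x\|$) and satisfies $\|x-iy\|=\|x+iy\|$; for example $\|x+iy\|=\sup_{\theta}\|(\cos\theta)x+(\sin\theta)y\|$ or, when $X$ is a Banach lattice, $\|x+iy\|=\bigl\|(|x|^2+|y|^2)^{1/2}\bigr\|$.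 **Proposition.** Let $k_1,\dots,k_n$ be nonnegative integers with $k_1+\cdots+k_n=m\ge 1$. Then the infima defining $\mathbb R(k_1,\dots,k_n;X)$ and $\mathbb C(k_1,\dots,k_n;\widetilde X)$ are taken over nonempty sets (so both constants are finite), and $$\mathbb R(k_1,\dots,k_n;X)\ \le\ 2^{m-1}\,\mathbb C(k_1,\dots,k_n;\widetilde X)\ \le\ 2^{m-1}\,\frac{m^m}{k_1^{k_1}\cdots k_n^{k_n}}\cdot\frac{k_1!\cdots k_n!}{m!},$$ where $0^0=1$. -/

import Mathlib

open scoped BigOperators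

set_option linter.unusedSectionVars false

noncomputable section

/-! ### Polarization constants -/

section Polarization

variable (𝕜 : Type*) [RCLike 𝕜] (E : Type*) [NormedAddCommGroup E] [NormedSpace 𝕜 E]

/-- Continuous `m`-linear forms on `E`. -/
abbrev MultilinearForm (m : ℕ) : Type _ :=
  ContinuousMultilinearMap 𝕜 (fun _ : Fin m => E) 𝕜

variable {𝕜 E}

/-- The form `L` is symmetric: its value does not change under permutations of its arguments. -/
def IsSymmForm {m : ℕ} (L : MultilinearForm 𝕜 E m) : Prop :=
  ∀ (σ : Equiv.Perm (Fin m)) (x : Fin m → E), L (fun j => x (σ j)) = L x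

/-- The norm `sup {|L(x, …, x)| : ‖x‖ ≤ 1}` of the homogeneous polynomial `x ↦ L(x, …, x)`
(a supremum of a nonempty set that is bounded, since `L` is continuous). -/
def polyNorm {m : ℕ} (L : MultilinearForm 𝕜 E m) : ℝ :=
  ⨆ x : Metric.closedBall (0 : E) 1, ‖L (fun _ => (x : E))‖

/-- `x₁, …, x₁, x₂, …, x₂, …, xₙ, …, xₙ`, where `xᵢ` occurs `kᵢ` times: the equivalence
`finSigmaFinEquiv` splits `Fin (k₁ + ⋯ + kₙ)` into consecutive blocks of lengths `k₁, …, kₙ`. -/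
def repeatVec {n : ℕ} (k : Fin n → ℕ) (x : Fin n → E) : Fin (∑ i, k i) → E :=
  fun j => x (finSigmaFinEquiv.symm j).1

variable (𝕜 E)

/-- The numbers `M > 0` with `|L(x₁^{k₁} … xₙ^{kₙ})| ≤ M ‖L̂‖` for all continuous symmetric
`m`-linear forms `L`, `m = k₁ + ⋯ + kₙ`, and all `x₁, …, xₙ` in the closed unit ball. -/
def polarizationBounds {n : ℕ} (k : Fin n → ℕ) : Set ℝ :=
  {M | 0 < M ∧ ∀ L : MultilinearForm 𝕜 E (∑ i, k i), IsSymmForm L →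
    ∀ x : Fin n → E, (∀ i, ‖x i‖ ≤ 1) → ‖L (repeatVec k x)‖ ≤ M * polyNorm L}

/-- The polarization constant `𝕂(k₁, …, kₙ; E)`. -/
def polarizationConst {n : ℕ} (k : Fin n → ℕ) : ℝ :=
  sInf (polarizationBounds 𝕜 E k)

end Polarization

/-! ### Complexifications of real normed spaces -/

/-- The underlying set `X × X` of `X ⊕ iX`; the pair `(x, y)` stands for `x + iy`. -/
def Complexification (X : Type*) : Type _ := X × X

namespace Complexification

section Algebra

variable {X : Type*}

/-- The element `x + iy`. -/
def mk (x y : X) : Complexification X := (x, y)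

/-- The real part. -/
def re (z : Complexification X) : X := Prod.fst z

/-- The imaginary part. -/
def im (z : Complexification X) : X := Prod.snd z

@[simp] theorem re_mk (x y : X) : (mk x y).re = x := rfl
@[simp] theorem im_mk (x y : X) : (mk x y).im = y := rfl

@[ext] theorem ext {z w : Complexification X} (h₁ : z.re = w.re) (h₂ : z.im = w.im) : z = w :=
  Prod.ext h₁ h₂

variable [AddCommGroup X]

/-- Componentwise addition. -/
instance : AddCommGroup (Complexification X) := inferInstanceAs (AddCommGroup (X × X))

@[simp] theorem re_add (z w : Complexification X) : (z + w).re = z.re + w.re := rfl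
@[simp] theorem im_add (z w : Complexification X) : (z + w).im = z.im + w.im := rfl
@[simp] theorem re_zero : (0 : Complexification X).re = 0 := rfl
@[simp] theorem im_zero : (0 : Complexification X).im = 0 := rfl

/-- The complex conjugate `x - iy` of `x + iy`. -/
def conj (z : Complexification X) : Complexification X := mk z.re (-z.im)

@[simp] theorem re_conj (z : Complexification X) : z.conj.re = z.re := rfl
@[simp] theorem im_conj (z : Complexification X) : z.conj.im = -z.im := rfl

variable [Module ℝ X]

/-- `(a + ib)(x + iy) = (a x - b y) + i (b x + a y)`. -/
instance : SMul ℂ (Complexification X) :=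
  ⟨fun c z => mk (c.re • z.re - c.im • z.im) (c.im • z.re + c.re • z.im)⟩

@[simp] theorem re_smul (c : ℂ) (z : Complexification X) :
    (c • z).re = c.re • z.re - c.im • z.im := rfl
@[simp] theorem im_smul (c : ℂ) (z : Complexification X) :
    (c • z).im = c.im • z.re + c.re • z.im := rfl

/-- `X ⊕ iX` is a complex vector space. -/
instance : Module ℂ (Complexification X) where
  one_smul z := by ext <;> simp
  mul_smul c d z := by ext <;> simp <;> module
  smul_zero c := by ext <;> simp
  smul_add c z w := by ext <;> simp <;> module
  add_smul c d z := by ext <;> simp <;> module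
  zero_smul z := by ext <;> simp

end Algebra

end Complexification

/-- A complexification norm for the real normed space `X`: a norm on the complex vector space
`X ⊕ iX` which extends the norm of `X` and is invariant under complex conjugation.
(Definiteness follows, see `eq_zero` below.) -/
structure ComplexificationNorm (X : Type*) [NormedAddCommGroup X] [NormedSpace ℝ X] extends
    Seminorm ℂ (Complexification X) where
  map_ofReal' : ∀ x : X, toFun (Complexification.mk x 0) = ‖x‖
  map_conj' : ∀ z : Complexification X, toFun z.conj = toFun z

namespace ComplexificationNorm

variable {X : Type*} [NormedAddCommGroup X] [NormedSpace ℝ X] (N : ComplexificationNorm X)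

theorem norm_re_le (z : Complexification X) : ‖z.re‖ ≤ N.toSeminorm z := by
  have h1 : N.toSeminorm (Complexification.mk ((2 : ℝ) • z.re) 0) = ‖(2 : ℝ) • z.re‖ :=
    N.map_ofReal' _
  have h2 : Complexification.mk ((2 : ℝ) • z.re) 0 = z + z.conj := by
    ext <;> simp [two_smul]
  have h3 : N.toSeminorm z.conj = N.toSeminorm z := N.map_conj' z
  have h4 := map_add_le_add N.toSeminorm z z.conj
  rw [← h2, h1, h3, norm_smul, Real.norm_ofNat] at h4
  linarith

theorem norm_im_le (z : Complexification X) : ‖z.im‖ ≤ N.toSeminorm z := by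
  have h := N.norm_re_le (Complex.I • z)
  rw [map_smul_eq_mul] at h
  simpa using h

theorem eq_zero (z : Complexification X) (h : N.toSeminorm z = 0) : z = 0 := by
  ext
  · exact norm_le_zero_iff.1 (h ▸ N.norm_re_le z)
  · exact norm_le_zero_iff.1 (h ▸ N.norm_im_le z)

/-- The complex normed space `X̃`: the complex vector space `X ⊕ iX` with the norm `N`. -/
def Space (_N : ComplexificationNorm X) : Type _ := Complexification X

instance : AddCommGroup N.Space := inferInstanceAs (AddCommGroup (Complexification X))

instance : Module ℂ N.Space := inferInstanceAs (Module ℂ (Complexification X))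

instance : NormedAddCommGroup N.Space :=
  AddGroupNorm.toNormedAddCommGroup
    { toFun := fun z => N.toSeminorm z
      map_zero' := map_zero N.toSeminorm
      add_le' := map_add_le_add N.toSeminorm
      neg' := map_neg_eq_map N.toSeminorm
      eq_zero_of_map_eq_zero' := N.eq_zero }

theorem norm_def (z : N.Space) : ‖z‖ = N.toSeminorm z := rfl

instance : NormedSpace ℂ N.Space where
  norm_smul_le c z := (map_smul_eq_mul N.toSeminorm c z).le

/-- If `X` is a Banach space, then so is `X̃`. -/
instance [CompleteSpace X] : CompleteSpace N.Space := by
  refine Metric.complete_of_cauchySeq_tendsto fun u hu => ?_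
  have key : ∀ f : N.Space → X, (∀ z w : N.Space, ‖f z - f w‖ ≤ ‖z - w‖) →
      ∃ a, Filter.Tendsto (fun n => f (u n)) Filter.atTop (nhds a) := by
    intro f hf
    refine cauchySeq_tendsto_of_complete (Metric.cauchySeq_iff.2 fun ε hε => ?_)
    obtain ⟨n, hn⟩ := Metric.cauchySeq_iff.1 hu ε hε
    refine ⟨n, fun i hi j hj => ?_⟩
    have := hn i hi j hj
    rw [dist_eq_norm] at this ⊢
    exact (hf _ _).trans_lt this
  obtain ⟨a, ha⟩ := key (fun z => Complexification.re z) fun z w => N.norm_re_le (z - w)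
  obtain ⟨b, hb⟩ := key (fun z => Complexification.im z) fun z w => N.norm_im_le (z - w)
  refine ⟨Complexification.mk a b, tendsto_iff_norm_sub_tendsto_zero.2 ?_⟩
  have hlim := ((tendsto_iff_norm_sub_tendsto_zero.1 ha).add
    (tendsto_iff_norm_sub_tendsto_zero.1 hb))
  rw [add_zero] at hlim
  refine squeeze_zero (fun _ => norm_nonneg _) (fun n => ?_) hlim
  set z : Complexification X := (show Complexification X from u n) - Complexification.mk a b with hz
  have h1 : z = Complexification.mk z.re 0 + Complex.I • Complexification.mk z.im 0 := by
    ext <;> simp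
  have h2 := map_add_le_add N.toSeminorm (Complexification.mk z.re 0)
    (Complex.I • Complexification.mk z.im 0)
  rw [← h1, map_smul_eq_mul, Complex.norm_I, one_mul] at h2
  have h3 : N.toSeminorm (Complexification.mk z.re 0) = ‖z.re‖ := N.map_ofReal' _
  have h4 : N.toSeminorm (Complexification.mk z.im 0) = ‖z.im‖ := N.map_ofReal' _
  rw [h3, h4] at h2
  exact h2

end ComplexificationNorm

/-! ### The standard complexification norms -/

namespace Complexification

variable {X : Type*} [NormedAddCommGroup X] [NormedSpace ℝ X]

/-- The real vector `(cos θ) x + (sin θ) y` attached to `x + iy`. -/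
def rot (z : Complexification X) (θ : ℝ) : X := Real.cos θ • z.re + Real.sin θ • z.im

theorem rot_add (z w : Complexification X) (θ : ℝ) : (z + w).rot θ = z.rot θ + w.rot θ := by
  simp only [rot, re_add, im_add]; module

theorem rot_smul (c : ℂ) (z : Complexification X) (θ : ℝ) :
    (c • z).rot θ = ‖c‖ • z.rot (θ - c.arg) := by
  have h1 : c.re = ‖c‖ * Real.cos c.arg := (Complex.norm_mul_cos_arg c).symm
  have h2 : c.im = ‖c‖ * Real.sin c.arg := (Complex.norm_mul_sin_arg c).symm
  simp only [rot, re_smul, im_smul, Real.cos_sub, Real.sin_sub]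
  rw [h1, h2]; module

theorem rot_conj (z : Complexification X) (θ : ℝ) : z.conj.rot θ = z.rot (-θ) := by
  simp [rot]

theorem norm_rot_le (z : Complexification X) (θ : ℝ) : ‖z.rot θ‖ ≤ ‖z.re‖ + ‖z.im‖ := by
  refine (norm_add_le _ _).trans (add_le_add ?_ ?_) <;> rw [norm_smul, Real.norm_eq_abs]
  · exact mul_le_of_le_one_left (norm_nonneg _) (Real.abs_cos_le_one _)
  · exact mul_le_of_le_one_left (norm_nonneg _) (Real.abs_sin_le_one _)

theorem bddAbove_rot (z : Complexification X) : BddAbove (Set.range fun θ => ‖z.rot θ‖) :=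
  ⟨_, Set.forall_mem_range.2 z.norm_rot_le⟩

end Complexification

/-- The norm `‖x + iy‖ = sup_θ ‖(cos θ) x + (sin θ) y‖`, available for every real normed space. -/
def taylorNorm (X : Type*) [NormedAddCommGroup X] [NormedSpace ℝ X] : ComplexificationNorm X where
  toSeminorm := Seminorm.of (fun z => ⨆ θ : ℝ, ‖z.rot θ‖)
    (fun z w => ciSup_le fun θ => by
      rw [Complexification.rot_add]
      exact (norm_add_le _ _).trans (add_le_add (le_ciSup z.bddAbove_rot θ)
        (le_ciSup w.bddAbove_rot θ)))
    (fun c z => by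
      simp only [Complexification.rot_smul, norm_smul, norm_norm]
      rw [← Real.mul_iSup_of_nonneg (norm_nonneg c)]
      congr 1
      exact (Equiv.subRight c.arg).iSup_congr (fun _ => rfl))
  map_ofReal' x := by
    change (⨆ θ : ℝ, ‖(Complexification.mk x 0).rot θ‖) = ‖x‖
    refine le_antisymm (ciSup_le fun θ => ?_) ?_
    · simpa using (Complexification.mk x (0 : X)).norm_rot_le θ
    · simpa [Complexification.rot] using le_ciSup (Complexification.mk x (0 : X)).bddAbove_rot 0
  map_conj' z := by
    change (⨆ θ : ℝ, ‖z.conj.rot θ‖) = ⨆ θ : ℝ, ‖z.rot θ‖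
    simp only [Complexification.rot_conj]
    exact (Equiv.neg ℝ).iSup_congr (fun _ => rfl)

/-! In a Banach lattice the modulus `(|x|² + |y|²)^{1/2} = sup_θ ((cos θ) x + (sin θ) y)` exists,
and its norm is a complexification norm; for `L^p` and `C(K)` it is the usual complex norm. -/

section BanachLattice

variable {X : Type*} [NormedAddCommGroup X] [Lattice X] [HasSolidNorm X] [IsOrderedAddMonoid X]
  [NormedSpace ℝ X] [PosSMulMono ℝ X]

namespace Complexification

theorem smul_le_smul_abs {a b : ℝ} (h : |a| ≤ b) (x : X) : a • x ≤ b • |x| := by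
  have h2 : a • x ≤ |a| • |x| := by
    rcases le_total 0 a with ha | ha
    · rw [abs_of_nonneg ha]; exact smul_le_smul_of_nonneg_left (le_abs_self x) ha
    · rw [abs_of_nonpos ha]
      have := smul_le_smul_of_nonneg_left (neg_le_abs x) (neg_nonneg.2 ha)
      simpa using this
  refine h2.trans ?_
  have := smul_nonneg (sub_nonneg.2 h) (abs_nonneg x)
  rw [sub_smul] at this
  exact sub_nonneg.1 this

theorem exists_isLUB_rot [CompleteSpace X] (z : Complexification X) :
    ∃ q : X, IsLUB (Set.range z.rot) q := by
  set u : X := |z.re| + |z.im| with hu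
  have hu0 : 0 ≤ u := add_nonneg (abs_nonneg _) (abs_nonneg _)
  have approx : ∀ ε : ℝ, 0 < ε → ∃ F : X, (∀ b : X, (∀ θ, z.rot θ ≤ b) → F ≤ b) ∧
      ∀ θ, z.rot θ ≤ F + ε • u := by
    intro ε hε
    obtain ⟨t, -, htf, hcov⟩ := finite_cover_balls_of_compact
      (isCompact_Icc (a := (0 : ℝ)) (b := 2 * Real.pi)) hε
    have hnear : ∀ θ : ℝ, ∃ η ∈ t, z.rot θ ≤ z.rot η + ε • u := by
      intro θ
      have hper : Function.Periodic z.rot (2 * Real.pi) := fun s => by simp [rot]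
      obtain ⟨θ', hθ', heq⟩ := hper.exists_mem_Ico₀ Real.two_pi_pos θ
      obtain ⟨η, hη, hd⟩ := Set.mem_iUnion₂.1 (hcov (Set.Ico_subset_Icc_self hθ'))
      refine ⟨η, hη, ?_⟩
      rw [Metric.mem_ball, Real.dist_eq] at hd
      have hc : |Real.cos θ' - Real.cos η| ≤ ε := (Real.abs_cos_sub_cos_le θ' η).trans hd.le
      have hs : |Real.sin θ' - Real.sin η| ≤ ε := (Real.abs_sin_sub_sin_le θ' η).trans hd.le
      have := add_le_add (smul_le_smul_abs hc z.re) (smul_le_smul_abs hs z.im)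
      rw [← smul_add, ← hu] at this
      rw [heq, ← sub_le_iff_le_add']
      refine le_trans (le_of_eq ?_) this
      simp only [rot]; module
    have htne : htf.toFinset.Nonempty := by
      obtain ⟨η, hη, -⟩ := hnear 0
      exact ⟨η, htf.mem_toFinset.2 hη⟩
    refine ⟨htf.toFinset.sup' htne z.rot, fun b hb => Finset.sup'_le _ _ fun η _ => hb η,
      fun θ => ?_⟩
    obtain ⟨η, hη, hle⟩ := hnear θ
    exact hle.trans (add_le_add_left (Finset.le_sup' z.rot (htf.mem_toFinset.2 hη)) _)
  choose F hF₁ hF₂ using fun n : ℕ => approx (1 / ((n : ℝ) + 1)) (by positivity)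
  have hle : ∀ i j, F i - F j ≤ (1 / ((j : ℝ) + 1)) • u := fun i j =>
    sub_le_iff_le_add'.2 (hF₁ i _ (hF₂ j))
  have hmono : ∀ i j : ℕ, j ≤ i → (1 / ((i : ℝ) + 1)) • u ≤ (1 / ((j : ℝ) + 1)) • u := by
    intro i j hij
    rw [← sub_nonneg, ← sub_smul]
    exact smul_nonneg (sub_nonneg.2 (one_div_le_one_div_of_le (by positivity)
      (by exact_mod_cast Nat.succ_le_succ hij))) hu0
  have hlim : Filter.Tendsto (fun n : ℕ => (1 / ((n : ℝ) + 1)) • u) Filter.atTop (nhds 0) := by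
    simpa using (tendsto_one_div_add_atTop_nhds_zero_nat (𝕜 := ℝ)).smul_const u
  have hcauchy : CauchySeq F := by
    refine cauchySeq_of_le_tendsto_0' (fun n => ‖(1 / ((n : ℝ) + 1)) • u‖) (fun j i hij => ?_)
      (by simpa using hlim.norm)
    rw [dist_eq_norm]
    refine norm_le_norm_of_abs_le_abs ((abs_le'.2 ⟨?_, ?_⟩).trans (le_abs_self _))
    · exact (hle j i).trans (hmono i j hij)
    · rw [neg_sub]; exact hle i j
  obtain ⟨q, hq⟩ := cauchySeq_tendsto_of_complete hcauchy
  refine ⟨q, ?_, fun b hb => le_of_tendsto' hq fun n => hF₁ n b fun θ => hb ⟨θ, rfl⟩⟩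
  rintro _ ⟨θ, rfl⟩
  exact ge_of_tendsto' (by simpa using hq.add hlim) fun n => hF₂ n θ

variable [CompleteSpace X]

/-- The modulus `sup_θ ((cos θ) x + (sin θ) y)` of `x + iy`. -/
def modulus (z : Complexification X) : X := z.exists_isLUB_rot.choose

theorem rot_le_modulus (z : Complexification X) (θ : ℝ) : z.rot θ ≤ z.modulus :=
  z.exists_isLUB_rot.choose_spec.1 ⟨θ, rfl⟩

theorem modulus_le {z : Complexification X} {b : X} (h : ∀ θ, z.rot θ ≤ b) : z.modulus ≤ b :=
  z.exists_isLUB_rot.choose_spec.2 (Set.forall_mem_range.2 h)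

theorem modulus_nonneg (z : Complexification X) : 0 ≤ z.modulus := by
  have h := add_le_add (z.rot_le_modulus 0) (z.rot_le_modulus Real.pi)
  have h0 : z.rot 0 + z.rot Real.pi = 0 := by simp [rot]
  rw [h0, ← two_smul ℝ z.modulus] at h
  simpa [smul_smul] using smul_le_smul_of_nonneg_left h (by norm_num : (0 : ℝ) ≤ 1 / 2)

theorem norm_le_norm_of_modulus {a b : X} (ha : 0 ≤ a) (h : a ≤ b) : ‖a‖ ≤ ‖b‖ :=
  norm_le_norm_of_abs_le_abs (by rwa [abs_of_nonneg ha, abs_of_nonneg (ha.trans h)])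

end Complexification

open Complexification in
/-- The norm `‖x + iy‖ = ‖(|x|² + |y|²)^{1/2}‖` on the complexification of a Banach lattice. -/
def latticeNorm (X : Type*) [NormedAddCommGroup X] [Lattice X] [HasSolidNorm X]
    [IsOrderedAddMonoid X] [NormedSpace ℝ X] [PosSMulMono ℝ X] [CompleteSpace X] :
    ComplexificationNorm X where
  toSeminorm := Seminorm.ofSMulLE (fun z => ‖z.modulus‖)
    (by
      have h : (0 : Complexification X).modulus = 0 :=
        le_antisymm (modulus_le fun θ => by simp [rot]) (modulus_nonneg _)
      rw [h, norm_zero])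
    (fun z w => by
      refine (norm_le_norm_of_modulus (modulus_nonneg _) (modulus_le fun θ => ?_)).trans
        (norm_add_le z.modulus w.modulus)
      rw [rot_add]
      exact add_le_add (z.rot_le_modulus θ) (w.rot_le_modulus θ))
    (fun c z => by
      rw [← norm_norm c, ← norm_smul]
      refine norm_le_norm_of_modulus (modulus_nonneg _) (modulus_le fun θ => ?_)
      rw [rot_smul]
      exact smul_le_smul_of_nonneg_left (z.rot_le_modulus _) (norm_nonneg c))
  map_ofReal' x := by
    change ‖(mk x 0).modulus‖ = ‖x‖
    have h : (mk x 0).modulus = |x| := by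
      refine le_antisymm (modulus_le fun θ => ?_) (abs_le'.2 ⟨?_, ?_⟩)
      · simpa [rot] using smul_le_smul_abs (Real.abs_cos_le_one θ) x
      · simpa [rot] using (mk x 0).rot_le_modulus 0
      · simpa [rot] using (mk x 0).rot_le_modulus Real.pi
    rw [h, norm_abs_eq_norm]
  map_conj' z := by
    change ‖z.conj.modulus‖ = ‖z.modulus‖
    congr 1
    refine le_antisymm (modulus_le fun θ => ?_) (modulus_le fun θ => ?_)
    · rw [rot_conj]; exact z.rot_le_modulus _
    · have := z.conj.rot_le_modulus (-θ)
      rwa [rot_conj, neg_neg] at this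

end BanachLattice

end

/-! Two averages over roots of unity carry the proof.

Harris' bound on a complex space is a Cauchy estimate. In `L((∑ tᵢ xᵢ)^m)` the coefficient of `∏
tᵢ^kᵢ` is `m! / ∏ kᵢ!` times `L(x₁^k₁ ⋯ xₙ^kₙ)`. Averaging over `tᵢ = ζ^aᵢ kᵢ/m` isolates it
(`sum_roots_of_unity_eq`), and each `∑ tᵢ xᵢ` lies in the unit ball since the moduli `kᵢ/m` sum to
1. This also makes the complex set of bounds nonempty.

To pass to the real space, a real form is extended complex-linearly to `X ⊕ iX` (`extend`). The
extension agrees with `L` on `X`, so it suffices that its polynomial norm grows by at most `2^(m-1)`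
(`norm_extend_le`). For `|a| = 1` the vector `a z + a⁻¹ z̄ = 2 Re(a z)` is real of norm at most 2,
so `L` there is at most `2^m ‖L̂‖`. A signed average over `m` values of `a` leaves only the terms in
`z^m` and `z̄^m` (`sum_rotations`); they are conjugate, and a suitable phase makes them equal to
`|L(z^m)|`. Hence `2 |L(z^m)| ≤ 2^m ‖L̂‖`. -/

section PolarizationBound

/-! ### Sums over roots of unity and counting maps by fibre sizes -/

theorem IsPrimitiveRoot.sum_range_pow_mul {ζ : ℂ} {N : ℕ} (h : IsPrimitiveRoot ζ N) (s : ℕ) :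
    ∑ l ∈ Finset.range N, ζ ^ (l * s) = if N ∣ s then (N : ℂ) else 0 := by
  split_ifs with hs
  · have h1 : ζ ^ s = 1 := (h.pow_eq_one_iff_dvd s).2 hs
    simp [mul_comm _ s, pow_mul, h1]
  · have h1 : ζ ^ s ≠ 1 := fun h' => hs ((h.pow_eq_one_iff_dvd s).1 h')
    have h2 := mul_geom_sum (ζ ^ s) N
    rw [← pow_mul, mul_comm s N, pow_mul, h.pow_eq_one, one_pow, sub_self] at h2
    simp only [mul_comm _ s, pow_mul]
    exact (mul_eq_zero.1 h2).resolve_left (sub_ne_zero.2 h1)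

/-- Bijections between corresponding fibres glue to a permutation. -/
theorem exists_comp_perm_eq {α ι : Type*} [Fintype α] [DecidableEq ι] {f g : α → ι}
    (h : ∀ i, Fintype.card {a // f a = i} = Fintype.card {a // g a = i}) :
    ∃ σ : Equiv.Perm α, g ∘ σ = f :=
  ⟨Equiv.ofFiberEquiv fun i => Fintype.equivOfCardEq (h i),
    funext fun a => Equiv.ofFiberEquiv_map _ a⟩

/-- Right multiplication by `τ⁻¹` carries this set to the stabilizer of `g`, a product of symmetric
groups of the fibres. -/
theorem card_comp_perm_eq {α ι : Type*} [Fintype α] [DecidableEq α] [Fintype ι] [DecidableEq ι]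
    (g : α → ι) (τ : Equiv.Perm α) :
    Fintype.card {σ : Equiv.Perm α // g ∘ σ = g ∘ τ} =
      ∏ i, (Fintype.card {a // g a = i}).factorial := by
  rw [← DomMulAct.stabilizer_card g]
  refine Fintype.card_congr ((Equiv.mulRight τ⁻¹).subtypeEquiv fun σ => ?_)
  simp only [Equiv.coe_mulRight, Equiv.Perm.coe_mul, funext_iff, Function.comp_apply]
  exact ⟨fun h a => by simpa using h (τ⁻¹ a), fun h a => by simpa using h (τ a)⟩

/-- The number of maps with the same fibre sizes as `g` is a multinomial coefficient. -/
theorem card_same_fibers_mul {α ι : Type*} [Fintype α] [DecidableEq α] [Fintype ι]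
    [DecidableEq ι] (g : α → ι) :
    (Finset.univ.filter fun f : α → ι =>
        ∀ i, Fintype.card {a // f a = i} = Fintype.card {a // g a = i}).card *
      ∏ i, (Fintype.card {a // g a = i}).factorial = (Fintype.card α).factorial := by
  set S := Finset.univ.filter fun f : α → ι =>
        ∀ i, Fintype.card {a // f a = i} = Fintype.card {a // g a = i} with hS
  have hmaps : ((Finset.univ : Finset (Equiv.Perm α)) : Set (Equiv.Perm α)).MapsTo
      (fun σ : Equiv.Perm α => g ∘ σ) (S : Set (α → ι)) := by
    intro σ _
    simp only [hS, Finset.coe_filter, Finset.mem_univ, true_and, Set.mem_ofPred_eq]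
    exact fun i => Fintype.card_congr (σ.subtypeEquiv fun a => Iff.rfl)
  -- All permutations are counted along `σ ↦ g ∘ σ`; every fibre over `S` has the same size.
  rw [← Fintype.card_perm, ← Finset.card_univ, Finset.card_eq_sum_card_fiberwise hmaps,
    Finset.sum_const_nat]
  intro f hf
  obtain ⟨τ, rfl⟩ := exists_comp_perm_eq (Finset.mem_filter.1 hf).2
  rw [← card_comp_perm_eq g τ, Fintype.card_subtype]

/-! ### Polynomial norms and polarization bounds -/

variable {𝕜 : Type*} [RCLike 𝕜] {E : Type*} [NormedAddCommGroup E] [NormedSpace 𝕜 E]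

theorem norm_apply_le_polyNorm {m : ℕ} (L : MultilinearForm 𝕜 E m) {x : E} (hx : ‖x‖ ≤ 1) :
    ‖L fun _ => x‖ ≤ polyNorm L := by
  have hb : BddAbove (Set.range fun x : Metric.closedBall (0 : E) 1 => ‖L fun _ => (x : E)‖) := by
    refine ⟨‖L‖, Set.forall_mem_range.2 fun y => ?_⟩
    exact L.unit_le_opNorm ((pi_norm_const_le _).trans (mem_closedBall_zero_iff.1 y.2))
  exact le_ciSup hb ⟨x, mem_closedBall_zero_iff.2 hx⟩

theorem polyNorm_le {m : ℕ} (L : MultilinearForm 𝕜 E m) {C : ℝ}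
    (h : ∀ x, ‖x‖ ≤ 1 → ‖L fun _ => x‖ ≤ C) : polyNorm L ≤ C := by
  have : Nonempty (Metric.closedBall (0 : E) 1) := ⟨⟨0, by simp⟩⟩
  exact ciSup_le fun x => h x (mem_closedBall_zero_iff.1 x.2)

theorem polarizationConst_le {n : ℕ} {k : Fin n → ℕ} {M : ℝ}
    (hM : M ∈ polarizationBounds 𝕜 E k) : polarizationConst 𝕜 E k ≤ M :=
  csInf_le ⟨0, fun _ h => h.1.le⟩ hM

theorem card_block {n : ℕ} (k : Fin n → ℕ) (i : Fin n) :
    Fintype.card {j : Fin (∑ i, k i) // (finSigmaFinEquiv.symm j).1 = i} = k i := by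
  rw [← Fintype.card_fin (k i)]
  refine Fintype.card_congr ((finSigmaFinEquiv.symm.subtypeEquiv fun _ => Iff.rfl).trans
    (Equiv.sigmaSubtype (β := fun i : Fin n => Fin (k i)) i))

/-! ### Harris' bound by coefficient extraction -/

theorem prod_comp_eq_prod_pow_card {α ι M : Type*} [Fintype α] [Fintype ι] [DecidableEq ι]
    [CommMonoid M] (f : α → ι) (t : ι → M) :
    ∏ a, t (f a) = ∏ i, t i ^ Fintype.card {a // f a = i} := by
  rw [← Fintype.prod_fiberwise']
  simp

/-- The coefficient extraction behind the Cauchy estimate for the polynomial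
`t ↦ L(∑ tᵢ xᵢ, …, ∑ tᵢ xᵢ)`, by averaging over roots of unity. -/
theorem sum_roots_of_unity_eq {E : Type*} [NormedAddCommGroup E] [NormedSpace ℂ E] {m n : ℕ}
    (L : MultilinearForm ℂ E m) {ζ : ℂ} (hζ : IsPrimitiveRoot ζ (m + 1)) (k : Fin n → ℕ)
    (hk : ∀ i, k i ≤ m) (r : Fin n → ℂ) (x : Fin n → E) :
    ∑ a ∈ Fintype.piFinset fun _ : Fin n => Finset.range (m + 1),
      (∏ i, ζ ^ (a i * (m + 1 - k i))) * L (fun _ => ∑ i, (ζ ^ a i * r i) • x i) =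
    (m + 1) ^ n * ∑ f ∈ Finset.univ.filter fun f : Fin m → Fin n =>
        ∀ i, Fintype.card {a // f a = i} = k i, (∏ i, r i ^ k i) * L (fun j => x (f j)) := by
  have h1 : ∀ a : Fin n → ℕ,
      (∏ i, ζ ^ (a i * (m + 1 - k i))) * L (fun _ => ∑ i, (ζ ^ a i * r i) • x i) =
      ∑ f : Fin m → Fin n, (∏ i, ζ ^ (a i * (m + 1 - k i + Fintype.card {j // f j = i}))) *
        ((∏ i, r i ^ Fintype.card {j // f j = i}) * L (fun j => x (f j))) := by
    intro a
    rw [L.map_sum, Finset.mul_sum]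
    refine Finset.sum_congr rfl fun f _ => ?_
    rw [L.map_smul_univ, prod_comp_eq_prod_pow_card f (fun i => ζ ^ a i * r i)]
    simp only [mul_add, pow_add, pow_mul, mul_pow, Finset.prod_mul_distrib, smul_eq_mul]
    ring
  simp only [h1]
  rw [Finset.sum_comm, Finset.mul_sum, Finset.sum_filter]
  refine Finset.sum_congr rfl fun f _ => ?_
  -- For fixed `f` the sum over all `a` factors into one geometric sum for each index `i`.
  rw [← Finset.sum_mul, ← Finset.prod_univ_sum (fun _ => Finset.range (m + 1))
    (fun i l => ζ ^ (l * (m + 1 - k i + Fintype.card {j // f j = i})))]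
  simp only [hζ.sum_range_pow_mul]
  -- The exponent `m + 1 - k i` plays the role of `-k i` modulo `m + 1`. Both the fibre size and `k
  -- i` lie in `[0, m]`, so congruence forces equality.
  have hdvd : ∀ i, m + 1 ∣ m + 1 - k i + Fintype.card {j // f j = i} ↔
      Fintype.card {j // f j = i} = k i := by
    intro i
    have hc : Fintype.card {j // f j = i} ≤ m := by
      simpa using Fintype.card_subtype_le fun j => f j = i
    have := hk i
    refine ⟨fun ⟨q, hq⟩ => ?_, fun h => ⟨1, by omega⟩⟩
    have hq1 : q = 1 := by
      have h2 : q < 2 := by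
        by_contra! h
        have := Nat.mul_le_mul_left (m + 1) h
        omega
      have h0 : q ≠ 0 := by rintro rfl; omega
      omega
    subst hq1; omega
  simp only [hdvd]
  split_ifs with hf
  · simp [hf]
  · obtain ⟨i, hi⟩ := not_forall.1 hf
    rw [Finset.prod_eq_zero (Finset.mem_univ i) (if_neg hi), zero_mul]

theorem IsSymmForm.apply_comp_eq {m n : ℕ} {L : MultilinearForm 𝕜 E m} (hL : IsSymmForm L)
    {f g : Fin m → Fin n}
    (h : ∀ i, Fintype.card {a // f a = i} = Fintype.card {a // g a = i}) (x : Fin n → E) :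
    L (fun j => x (f j)) = L (fun j => x (g j)) := by
  obtain ⟨σ, rfl⟩ := exists_comp_perm_eq h
  exact hL σ fun j => x (g j)

theorem prod_pow_self_pos {ι : Type*} [Fintype ι] (k : ι → ℕ) :
    0 < ∏ i, (k i : ℝ) ^ k i :=
  Finset.prod_pos fun i _ => by exact_mod_cast Nat.pow_self_pos

/-- Harris' bound for the values of a symmetric form on a complex normed space. -/
theorem IsSymmForm.norm_apply_comp_le {E : Type*} [NormedAddCommGroup E] [NormedSpace ℂ E]
    {n m : ℕ} (hm : 1 ≤ m) {L : MultilinearForm ℂ E m} (hL : IsSymmForm L) {k : Fin n → ℕ}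
    (hmdef : ∑ i, k i = m) {g : Fin m → Fin n} (hgk : ∀ i, Fintype.card {j // g j = i} = k i)
    {x : Fin n → E} (hx : ∀ i, ‖x i‖ ≤ 1) :
    ‖L fun j => x (g j)‖ ≤ (m : ℝ) ^ m / (∏ i, (k i : ℝ) ^ k i) *
        ((∏ i, ((k i).factorial : ℝ)) / (m.factorial : ℝ)) * polyNorm L := by
  have hm0 : (0 : ℝ) < m := by exact_mod_cast hm
  have hkk : 0 < ∏ i, (k i : ℝ) ^ k i := prod_pow_self_pos k
  have hkf : 0 < ∏ i, ((k i).factorial : ℝ) := Finset.prod_pos fun i _ => by positivity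
  have hmf : (0 : ℝ) < m.factorial := by positivity
  have hζ := Complex.isPrimitiveRoot_exp (m + 1) (by omega)
  set ζ := Complex.exp (2 * Real.pi * Complex.I / ((m + 1 : ℕ) : ℂ)) with hζdef
  have hζ1 : ‖ζ‖ = 1 := hζ.norm'_eq_one (by omega)
  have hkm : ∀ i, k i ≤ m := fun i => Finset.single_le_sum (fun _ _ => Nat.zero_le _)
    (Finset.mem_univ i) |>.trans_eq hmdef
  -- The radii `k i / m` maximise `∏ rᵢ ^ kᵢ` among nonnegative `rᵢ` of sum 1.
  have hsum := sum_roots_of_unity_eq L hζ k hkm (fun i => ((k i / m : ℝ) : ℂ)) x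
  set S := Finset.univ.filter fun f : Fin m → Fin n => ∀ i, Fintype.card {a // f a = i} = k i
    with hS
  have hcard : (S.card : ℝ) * ∏ i, ((k i).factorial : ℝ) = m.factorial := by
    have := card_same_fibers_mul g
    simp only [hgk, Fintype.card_fin] at this
    exact_mod_cast this
  have hconst : ∀ f ∈ S, L (fun j => x (f j)) = L (fun j => x (g j)) := fun f hf =>
    hL.apply_comp_eq (g := g) (fun i => ((Finset.mem_filter.1 hf).2 i).trans (hgk i).symm) x
  have hsum' : ∑ f ∈ S, (∏ i, ((k i / m : ℝ) : ℂ) ^ k i) * L (fun j => x (f j)) =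
      S.card • ((∏ i, ((k i / m : ℝ) : ℂ) ^ k i) * L (fun j => x (g j))) := by
    rw [← Finset.sum_const]
    exact Finset.sum_congr rfl fun f hf => by rw [hconst f hf]
  rw [hsum'] at hsum
  have hle : ‖∑ a ∈ Fintype.piFinset fun _ : Fin n => Finset.range (m + 1),
      (∏ i, ζ ^ (a i * (m + 1 - k i))) *
        L (fun _ => ∑ i, (ζ ^ a i * ((k i / m : ℝ) : ℂ)) • x i)‖ ≤ (m + 1) ^ n * polyNorm L := by
    refine (norm_sum_le_of_le _ fun a _ => (?_ : _ ≤ polyNorm L)).trans ?_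
    · rw [norm_mul, norm_prod]
      simp only [norm_pow, hζ1, one_pow, Finset.prod_const_one, one_mul]
      refine norm_apply_le_polyNorm L ?_
      calc ‖∑ i, (ζ ^ a i * ((k i / m : ℝ) : ℂ)) • x i‖ ≤ ∑ i, (k i / m : ℝ) := by
            refine norm_sum_le_of_le _ fun i _ => ?_
            rw [norm_smul, norm_mul, norm_pow, hζ1, one_pow, one_mul, Complex.norm_real,
              Real.norm_of_nonneg (by positivity)]
            exact mul_le_of_le_one_right (by positivity) (hx i)
        _ = 1 := by
            rw [← Finset.sum_div, ← Nat.cast_sum, hmdef, div_self hm0.ne']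
    · simp
  rw [hsum, norm_mul, nsmul_eq_mul, norm_mul, norm_mul, norm_prod] at hle
  have e1 : ‖((m : ℂ) + 1) ^ n‖ = (m + 1 : ℝ) ^ n := by
    rw [norm_pow]; congr 1
    exact_mod_cast Complex.norm_natCast (m + 1)
  have e2 : ∏ i, ‖((k i / m : ℝ) : ℂ) ^ k i‖ = (∏ i, (k i : ℝ) ^ k i) / (m : ℝ) ^ m := by
    simp only [norm_pow, Complex.norm_real]
    rw [Finset.prod_congr rfl fun i _ => by
      rw [Real.norm_of_nonneg (by positivity : (0 : ℝ) ≤ k i / m), div_pow],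
      Finset.prod_div_distrib, Finset.prod_pow_eq_pow_sum, hmdef]
  rw [e1, e2, Complex.norm_natCast] at hle
  have h3 := le_of_mul_le_mul_left hle (by positivity)
  rw [← hcard]
  have hS0 : 0 < (S.card : ℝ) := by
    rw [← hcard] at hmf
    exact pos_of_mul_pos_left hmf hkf.le
  calc ‖L fun j => x (g j)‖ = (m : ℝ) ^ m / (∏ i, (k i : ℝ) ^ k i) / S.card *
        (S.card * ((∏ i, (k i : ℝ) ^ k i) / (m : ℝ) ^ m * ‖L fun j => x (g j)‖)) := by
        field_simp
    _ ≤ (m : ℝ) ^ m / (∏ i, (k i : ℝ) ^ k i) / S.card * polyNorm L := by gcongr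
    _ = _ := by field_simp

theorem harris_mem_polarizationBounds (E : Type*) [NormedAddCommGroup E] [NormedSpace ℂ E]
    {n m : ℕ} (k : Fin n → ℕ) (hkm : ∑ i, k i = m) (hm : 1 ≤ m) :
    (m : ℝ) ^ m / (∏ i, (k i : ℝ) ^ k i) *
        ((∏ i, ((k i).factorial : ℝ)) / (m.factorial : ℝ)) ∈ polarizationBounds ℂ E k := by
  subst hkm
  have hm0 : (0 : ℝ) < (∑ i, k i : ℕ) := by exact_mod_cast hm
  have hkk := prod_pow_self_pos k
  have hkf : 0 < ∏ i, ((k i).factorial : ℝ) := Finset.prod_pos fun i _ => by positivity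
  exact ⟨by positivity, fun L hL x hx => hL.norm_apply_comp_le hm rfl (card_block k) hx⟩

end PolarizationBound
noncomputable section

/-! ### The complex-linear extension of a real form -/

namespace ComplexificationNorm

variable {X : Type*} [NormedAddCommGroup X] [NormedSpace ℝ X] (N : ComplexificationNorm X)

/-- The embedding of the pair `(x, y)` as `x + iy`. -/
def toSpace (x y : X) : N.Space := Complexification.mk x y

/-- The imaginary part of `z` for `b = true`, its real part for `b = false`. -/
def part (b : Bool) (z : N.Space) : X :=
  if b then Complexification.im z else Complexification.re z

/-- The complex conjugate of `z`. -/
def star (z : N.Space) : N.Space := Complexification.conj z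

variable {N}

theorem space_ext {z w : N.Space} (h : ∀ b, part N b z = part N b w) : z = w :=
  Complexification.ext (h false) (h true)

theorem part_add (b : Bool) (z w : N.Space) : part N b (z + w) = part N b z + part N b w := by
  cases b <;> rfl

/-- Indexing both coordinates by `Bool` makes multiplication by `i` a flip of the index with a sign.
-/
theorem part_smul (b : Bool) (c : ℂ) (z : N.Space) :
    part N b (c • z) = c.re • part N b z + (if b then c.im else -c.im) • part N (!b) z := by
  cases b
  · exact (Complexification.re_smul c z).trans (by simp [part, sub_eq_add_neg])
  · exact (Complexification.im_smul c z).trans (by simp [part, add_comm])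

theorem part_star (b : Bool) (z : N.Space) :
    part N b (star N z) = (if b then (-1 : ℝ) else 1) • part N b z := by
  cases b
  · exact (Complexification.re_conj z).trans (one_smul ℝ _).symm
  · exact (Complexification.im_conj z).trans (neg_one_smul ℝ _).symm

theorem part_toSpace (b : Bool) (x y : X) : part N b (toSpace N x y) = if b then y else x := by
  cases b <;> rfl

theorem norm_toSpace_zero (x : X) : ‖toSpace N x 0‖ = ‖x‖ := N.map_ofReal' x

theorem norm_part_le (b : Bool) (z : N.Space) : ‖part N b z‖ ≤ ‖z‖ := by
  cases b
  · exact N.norm_re_le z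
  · exact N.norm_im_le z

theorem continuous_part (b : Bool) : Continuous (part N b) := by
  refine LipschitzWith.continuous (K := 1) (LipschitzWith.of_dist_le_mul fun z w => ?_)
  rw [dist_eq_norm, dist_eq_norm, NNReal.coe_one, one_mul]
  have h : part N b (z - w) = part N b z - part N b w := by
    rw [eq_sub_iff_add_eq, ← part_add, sub_add_cancel]
  rw [← h]
  exact norm_part_le b _

theorem add_star_eq_toSpace (z : N.Space) :
    z + star N z = toSpace N ((2 : ℝ) • part N false z) 0 := by
  refine space_ext fun b => ?_
  rw [part_add, part_star, part_toSpace]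
  cases b <;> simp [two_smul]

theorem star_smul (c : ℂ) (z : N.Space) :
    star N (c • z) = (starRingEnd ℂ c) • star N z := by
  refine space_ext fun b => ?_
  simp only [part_star, part_smul]
  cases b <;> simp

/-- The weight `1` of the real part, `i` of the imaginary part. -/
def weight (b : Bool) : ℂ := if b then Complex.I else 1

variable (N)

/-- The term with index `e` of the expansion of `L(x₁ + i y₁, …, xₘ + i yₘ)`. -/
def term {m : ℕ} (L : MultilinearForm ℝ X m) (z : Fin m → N.Space) (e : Fin m → Bool) : ℂ :=
  (∏ j, weight (e j)) * (L fun j => part N (e j) (z j) : ℝ)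

variable {N}

theorem part_update {m : ℕ} (z : Fin m → N.Space) (i : Fin m) (w : N.Space) (e : Fin m → Bool) :
    (fun j => part N (e j) (Function.update z i w j)) =
      Function.update (fun j => part N (e j) (z j)) i (part N (e i) w) := by
  ext j
  rcases eq_or_ne j i with rfl | h
  · simp
  · simp [h]

/-- The imaginary part of `c` swaps the coordinates of `w`, hence pairs `e` with `e` flipped at `i`;
the quotient of the two weights absorbs the sign. -/
theorem term_update_smul {m : ℕ} (L : MultilinearForm ℝ X m) (z : Fin m → N.Space) (i : Fin m)
    (c : ℂ) (w : N.Space) (e : Fin m → Bool) :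
    term N L (Function.update z i (c • w)) e = c.re * term N L (Function.update z i w) e +
      (c.im * Complex.I) * term N L (Function.update z i w) (Function.update e i (!e i)) := by
  have h1 : ∏ j, weight (Function.update e i (!e i) j) =
      weight (!e i) * ∏ j ∈ Finset.univ.erase i, weight (e j) := by
    rw [← Finset.mul_prod_erase _ _ (Finset.mem_univ i), Function.update_self]
    congr 1
    exact Finset.prod_congr rfl fun j hj => by
      rw [Function.update_of_ne (Finset.ne_of_mem_erase hj)]
  have h2 : (fun j => part N (Function.update e i (!e i) j) (Function.update z i w j)) =
      Function.update (fun j => part N (e j) (z j)) i (part N (!e i) w) := by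
    ext j
    rcases eq_or_ne j i with rfl | h
    · simp
    · simp [h]
  simp only [term]
  rw [h1, h2, ← Finset.mul_prod_erase _ _ (Finset.mem_univ i)]
  simp only [part_update, part_smul, L.map_update_add, L.map_update_smul, smul_eq_mul]
  push_cast
  set P := ∏ j ∈ Finset.univ.erase i, weight (e j)
  cases e i
  · simp only [weight, Bool.not_false, Bool.false_eq_true, if_true, if_false]
    push_cast
    linear_combination (-(c.im : ℂ) * P *
      (L (Function.update (fun j => part N (e j) (z j)) i (part N true w)) : ℝ)) * Complex.I_sq
  · simp only [weight, Bool.not_true, Bool.false_eq_true, if_true, if_false]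
    ring

/-- The complex-linear extension of a real multilinear form. -/
def extend {m : ℕ} (L : MultilinearForm ℝ X m) : MultilinearForm ℂ N.Space m where
  toFun z := ∑ e : Fin m → Bool, term N L z e
  map_update_add' {inst} z i v w := by
    obtain rfl : inst = instDecidableEqFin m := Subsingleton.elim _ _
    rw [← Finset.sum_add_distrib]
    refine Finset.sum_congr rfl fun e _ => ?_
    simp only [term, part_update, part_add, L.map_update_add]
    push_cast; ring
  map_update_smul' {inst} z i c w := by
    obtain rfl : inst = instDecidableEqFin m := Subsingleton.elim _ _
    simp only [term_update_smul, Finset.sum_add_distrib, ← Finset.mul_sum]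
    -- Flipping at `i` permutes the index set, so the two sums in `term_update_smul` coincide and
    -- their factors combine to `c.re + c.im * I = c`.
    have hinv : Function.Involutive fun e : Fin m → Bool => Function.update e i (!e i) := by
      intro e; simp
    have h := Equiv.sum_comp hinv.toPerm fun e => term N L (Function.update z i w) e
    rw [Function.Involutive.coe_toPerm] at h
    rw [h, ← add_mul, Complex.re_add_im, smul_eq_mul]
  cont := by
    refine continuous_finsetSum _ fun e _ => continuous_const.mul
      (Complex.continuous_ofReal.comp (L.cont.comp (continuous_pi fun j =>
        (continuous_part (e j)).comp (continuous_apply j))))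

theorem extend_apply {m : ℕ} (L : MultilinearForm ℝ X m) (z : Fin m → N.Space) :
    extend L z = ∑ e : Fin m → Bool, term N L z e := rfl

theorem extend_isSymmForm {m : ℕ} {L : MultilinearForm ℝ X m} (hL : IsSymmForm L) :
    IsSymmForm (extend (N := N) L) := by
  intro σ z
  rw [extend_apply, extend_apply, ← Equiv.sum_comp (Equiv.arrowCongr σ.symm (Equiv.refl Bool))]
  refine Finset.sum_congr rfl fun e _ => ?_
  simp only [term]
  congr 1
  · exact Equiv.prod_comp σ fun j => weight (e j)
  · exact congrArg _ (hL σ fun j => part N (e j) (z j))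

/-- Any choice `e` that selects an imaginary part puts a zero argument into `L`. -/
theorem extend_toSpace {m : ℕ} (L : MultilinearForm ℝ X m) (x : Fin m → X) :
    extend L (fun j => toSpace N (x j) 0) = (L x : ℂ) := by
  rw [extend_apply, Finset.sum_eq_single fun _ => false]
  · simp [term, weight, part_toSpace]
  · intro e _ he
    obtain ⟨i, hi⟩ := Function.ne_iff.1 he
    have hi' : e i = true := by simpa using hi
    rw [term, L.map_coord_zero i (by simp [part_toSpace, hi'])]
    simp
  · simp

/-- Each selected imaginary part contributes a sign `-1`, which turns the weight `i` into its
conjugate. -/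
theorem extend_star {m : ℕ} (L : MultilinearForm ℝ X m) (z : Fin m → N.Space) :
    extend L (fun j => star N (z j)) = starRingEnd ℂ (extend L z) := by
  rw [extend_apply, extend_apply, map_sum]
  refine Finset.sum_congr rfl fun e _ => ?_
  simp only [term, part_star, L.map_smul_univ, map_mul, map_prod, Complex.conj_ofReal, smul_eq_mul]
  push_cast
  rw [← mul_assoc, ← Finset.prod_mul_distrib]
  congr 1
  refine Finset.prod_congr rfl fun j _ => ?_
  cases e j <;> simp [weight]

/-! ### The norm of the extension -/

/-- Averaging over the `2m`-th roots of unity isolates the two extreme frequencies of the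
trigonometric polynomial `a ↦ L((a z + a⁻¹ w)^m)`, `|a| = 1`. -/
theorem sum_rotations {E : Type*} [NormedAddCommGroup E] [NormedSpace ℂ E] {m : ℕ} (hm : 1 ≤ m)
    (L : MultilinearForm ℂ E m) {ω : ℂ} (hω : IsPrimitiveRoot ω (2 * m)) {u : ℂ} (hu : u ≠ 0)
    (z w : E) :
    ∑ l ∈ Finset.range m, ω ^ (l * m) * L (fun _ => (u * ω ^ l) • z + (u * ω ^ l)⁻¹ • w) =
      m * (u ^ m * L (fun _ => z) + (u ^ m)⁻¹ * L (fun _ => w)) := by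
  have hω0 : ω ≠ 0 := hω.ne_zero (by omega)
  have hω2 : IsPrimitiveRoot (ω ^ 2) m := hω.pow (by omega) rfl
  have h1 : ∀ l, ω ^ (l * m) * L (fun _ => (u * ω ^ l) • z + (u * ω ^ l)⁻¹ • w) =
      ∑ s : Finset (Fin m), (ω ^ 2) ^ (l * s.card) *
        (u ^ s.card * (u ^ (m - s.card))⁻¹ * L (s.piecewise (fun _ => z) (fun _ => w))) := by
    intro l
    have h2 := L.map_add_univ (fun _ => (u * ω ^ l) • z) (fun _ => (u * ω ^ l)⁻¹ • w)
    rw [show (fun _ : Fin m => (u * ω ^ l) • z + (u * ω ^ l)⁻¹ • w) =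
      (fun _ => (u * ω ^ l) • z) + (fun _ => (u * ω ^ l)⁻¹ • w) from rfl, h2, Finset.mul_sum]
    refine Finset.sum_congr rfl fun s _ => ?_
    have h3 : s.piecewise (fun _ => (u * ω ^ l) • z) (fun _ => (u * ω ^ l)⁻¹ • w) =
        fun j => s.piecewise (fun _ => u * ω ^ l) (fun _ => (u * ω ^ l)⁻¹) j •
          s.piecewise (fun _ => z) (fun _ => w) j := by
      ext j
      by_cases hj : j ∈ s <;> simp [hj]
    have h4 : ∏ j, s.piecewise (fun _ => u * ω ^ l) (fun _ => (u * ω ^ l)⁻¹) j =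
        (u * ω ^ l) ^ s.card * ((u * ω ^ l)⁻¹) ^ (m - s.card) := by
      rw [Finset.prod_piecewise]
      simp [Finset.card_univ_sdiff]
    obtain ⟨d, hd⟩ := Nat.exists_eq_add_of_le (show s.card ≤ m by simpa using s.card_le_univ)
    have hd' : m - s.card = d := by omega
    rw [h3, L.map_smul_univ, h4, hd', smul_eq_mul]
    -- A term with `|s|` copies of `z` has frequency `2|s| - m`; the factor `ω ^ (l * m)` shifts it
    -- to `2|s|`, leaving powers of `ω ^ 2`, a primitive `m`-th root of unity.
    have h5 : ω ^ (l * m) * ((u * ω ^ l) ^ s.card * ((u * ω ^ l)⁻¹) ^ d) =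
        (ω ^ 2) ^ (l * s.card) * (u ^ s.card * (u ^ d)⁻¹) := by
      rw [show l * m = l * (s.card + d) from congrArg (l * ·) hd]
      have hW : ω ^ l ≠ 0 := pow_ne_zero l hω0
      rw [← pow_mul, show 2 * (l * s.card) = l * (s.card + s.card) by ring, pow_mul, pow_mul]
      generalize ω ^ l = W at hW
      rw [inv_pow, mul_pow, mul_pow, pow_add, pow_add]
      field_simp
    rw [← mul_assoc, h5]
    ring
  simp only [h1]
  rw [Finset.sum_comm]
  simp only [← Finset.sum_mul, hω2.sum_range_pow_mul]
  have : NeZero m := ⟨by omega⟩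
  have hne : (∅ : Finset (Fin m)) ≠ Finset.univ := Finset.univ_nonempty.ne_empty.symm
  -- As `|s| ≤ m`, only `s = ∅` and `s = univ` have `m ∣ |s|`.
  rw [← Finset.sum_subset (Finset.subset_univ {∅, Finset.univ}), Finset.sum_pair hne]
  · simp
    ring
  · intro s _ hs
    simp only [Finset.mem_insert, Finset.mem_singleton, not_or] at hs
    have hpos : 0 < s.card := Finset.card_pos.2 (Finset.nonempty_iff_ne_empty.2 hs.1)
    have hlt : s.card < m := by
      have := (Finset.card_lt_iff_ne_univ s).2 hs.2
      simpa using this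
    rw [if_neg (Nat.not_dvd_of_pos_of_lt hpos hlt), zero_mul]

theorem norm_extend_le {m : ℕ} (hm : 1 ≤ m) (L : MultilinearForm ℝ X m) {z : N.Space}
    (hz : ‖z‖ ≤ 1) : ‖extend L fun _ => z‖ ≤ 2 ^ (m - 1) * polyNorm L := by
  set v : ℂ := extend L fun _ => z with hv
  -- This phase makes `u ^ m * v` real and nonnegative, so the two conjugate extreme terms add up to
  -- `2 ‖v‖`.
  obtain ⟨u, hu1, huv⟩ : ∃ u : ℂ, ‖u‖ = 1 ∧ u ^ m * v = ‖v‖ := by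
    refine ⟨Complex.exp ((-(v.arg / m) : ℝ) * Complex.I), Complex.norm_exp_ofReal_mul_I _, ?_⟩
    nth_rewrite 2 [← Complex.norm_mul_exp_arg_mul_I v]
    have hm0 : (m : ℂ) ≠ 0 := by exact_mod_cast (by omega : m ≠ 0)
    rw [← Complex.exp_nat_mul, mul_left_comm, ← Complex.exp_add]
    have : (m : ℂ) * ((-(v.arg / m) : ℝ) * Complex.I) + v.arg * Complex.I = 0 := by
      push_cast; field_simp; ring
    rw [this, Complex.exp_zero, mul_one]
  have hω := Complex.isPrimitiveRoot_exp (2 * m) (by omega)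
  set ω := Complex.exp (2 * Real.pi * Complex.I / ((2 * m : ℕ) : ℂ)) with hωdef
  have hω1 : ‖ω‖ = 1 := hω.norm'_eq_one (by omega)
  have hinv : ∀ a : ℂ, ‖a‖ = 1 → a⁻¹ = starRingEnd ℂ a := fun a ha => by
    rw [Complex.inv_def, Complex.normSq_eq_norm_sq, ha]; simp
  have hu0 : u ≠ 0 := norm_ne_zero_iff.1 (by rw [hu1]; exact one_ne_zero)
  have hsum := sum_rotations hm (extend L) hω hu0 z (star N z)
  have hright : (m : ℂ) * (u ^ m * extend L (fun _ => z) +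
      (u ^ m)⁻¹ * extend L (fun _ => star N z)) = ((2 * m * ‖v‖ : ℝ) : ℂ) := by
    rw [extend_star, ← hv, huv, hinv (u ^ m) (by rw [norm_pow, hu1, one_pow]), ← map_mul, huv,
      Complex.conj_ofReal]
    push_cast; ring
  rw [hright] at hsum
  have hle : ‖∑ l ∈ Finset.range m, ω ^ (l * m) *
      extend L (fun _ => (u * ω ^ l) • z + (u * ω ^ l)⁻¹ • star N z)‖ ≤
      m * (2 ^ m * polyNorm L) := by
    refine (norm_sum_le_of_le _ fun l _ => (?_ : _ ≤ 2 ^ m * polyNorm L)).trans (by simp)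
    have ha : ‖u * ω ^ l‖ = 1 := by rw [norm_mul, norm_pow, hu1, hω1, one_pow, one_mul]
    -- With `a = u * ω ^ l` of modulus 1, the argument is `a z` plus its conjugate, that is `2 Re(a
    -- z)`; homogeneity of `L` gives the factor `2 ^ m`.
    rw [norm_mul, norm_pow, hω1, one_pow, one_mul, hinv _ ha, ← star_smul, add_star_eq_toSpace,
      extend_toSpace, L.map_smul_univ (fun _ => (2 : ℝ)), Complex.norm_real, norm_smul]
    have hx : ‖part N false ((u * ω ^ l) • z)‖ ≤ 1 :=
      (norm_part_le _ _).trans (by rw [norm_smul, ha, one_mul]; exact hz)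
    simpa using norm_apply_le_polyNorm L hx
  rw [hsum, Complex.norm_real, Real.norm_of_nonneg (by positivity)] at hle
  have hm0 : (0 : ℝ) < m := by exact_mod_cast hm
  -- Cancelling the 2 from the two extreme terms lowers `2 ^ m` to `2 ^ (m - 1)`.
  have hpow : (2 : ℝ) ^ m = 2 * 2 ^ (m - 1) := by rw [← pow_succ']; congr 1; omega
  rw [hpow] at hle
  refine le_of_mul_le_mul_left ?_ (by positivity : (0 : ℝ) < 2 * m)
  linarith

theorem mul_mem_polarizationBounds {n : ℕ} {k : Fin n → ℕ} (hm : 1 ≤ ∑ i, k i) {M : ℝ}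
    (hM : M ∈ polarizationBounds ℂ N.Space k) :
    2 ^ (∑ i, k i - 1) * M ∈ polarizationBounds ℝ X k := by
  refine ⟨mul_pos (by positivity) hM.1, fun L hL x hx => ?_⟩
  have h1 := hM.2 (extend L) (extend_isSymmForm hL) (fun i => toSpace N (x i) 0)
    fun i => (norm_toSpace_zero (x i)).trans_le (hx i)
  have h2 : extend L (repeatVec k fun i => toSpace N (x i) 0) = (L (repeatVec k x) : ℂ) :=
    extend_toSpace L (repeatVec k x)
  rw [h2, Complex.norm_real] at h1
  have h3 : polyNorm (extend (N := N) L) ≤ 2 ^ (∑ i, k i - 1) * polyNorm L :=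
    polyNorm_le _ fun z hz => norm_extend_le hm L hz
  calc ‖L (repeatVec k x)‖ ≤ M * polyNorm (extend (N := N) L) := h1
    _ ≤ M * (2 ^ (∑ i, k i - 1) * polyNorm L) := mul_le_mul_of_nonneg_left h3 hM.1.le
    _ = _ := by ring

end ComplexificationNorm

end

/-! ### The comparison of the constants -/

theorem proposition4p1 (X : Type*) [NormedAddCommGroup X] [NormedSpace ℝ X] [CompleteSpace X]
    (N : ComplexificationNorm X) (n m : ℕ) (k : Fin n → ℕ) (hkm : ∑ i, k i = m) (hm : 1 ≤ m) :
    (polarizationBounds ℝ X k).Nonempty ∧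
    (polarizationBounds ℂ N.Space k).Nonempty ∧
    polarizationConst ℝ X k ≤ 2 ^ (m - 1) * polarizationConst ℂ N.Space k ∧
    2 ^ (m - 1) * polarizationConst ℂ N.Space k ≤
      2 ^ (m - 1) * ((m : ℝ) ^ m / (∏ i, (k i : ℝ) ^ k i) *
        ((∏ i, ((k i).factorial : ℝ)) / (m.factorial : ℝ))) := by
  have hC := harris_mem_polarizationBounds N.Space k hkm hm
  have hR : ∀ M ∈ polarizationBounds ℂ N.Space k, 2 ^ (m - 1) * M ∈ polarizationBounds ℝ X k := by
    subst hkm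
    exact fun M hM => ComplexificationNorm.mul_mem_polarizationBounds hm hM
  refine ⟨⟨_, hR _ hC⟩, ⟨_, hC⟩, ?_,
    mul_le_mul_of_nonneg_left (polarizationConst_le hC) (by positivity)⟩
  -- Dividing by `2 ^ (m - 1)` reduces the claim to a lower bound for every admissible complex `M`.
  rw [← div_le_iff₀' (by positivity)]
  refine le_csInf ⟨_, hC⟩ fun M hM => ?_
  rw [div_le_iff₀' (by positivity)]
  exact polarizationConst_le (hR M hM)
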